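/- Let $X$ be a real Banach space whose dual $X^{*}$ is rotund (that is, strictly convex). For a nonempty closed set $K\subseteq X$ and $x\in X$ put $d_K(x)=\inf\{\|x-k\| : k\in K\}$ and $P_K(x)=\{k\in K : \|x-k\|=d_K(x)\}$; the elements of $P_K(x)$ are the closest points of $K$ to $x$. A nonempty closed set $K$ is called Chebyshev if $P_K(x)$ is a singleton for every $x\in X\setminus K$. It is called almost proximinal if $\{x\in X\setminus K : P_K(x)\neq\emptyset\}$ is dense in $X\setminus K$. An almost proximinal set $K$ is called an almost sun if the set of all $x\in X\setminus K$ that have a closest point $p\in P_K(x)$ with $$p\in P_K\Big(x+t\,\frac{x-p}{\|x-p\|}\Big)\quad\text{for all } t\ge 0$$ is dense in $X\setminus K$. Then a Chebyshev set $K\subseteq X$ is convex if and only if it is an almost sun. -/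

import Mathlib

/-- The metric projection `P_K(x) = {k ∈ K : ‖x - k‖ = d_K(x)}`, where the distance function
`d_K(x) = inf {‖x - k‖ : k ∈ K}` is Mathlib's `Metric.infDist x K`. -/
def metricProjection {X : Type*} [NormedAddCommGroup X] (K : Set X) (x : X) : Set X :=
  {k : X | k ∈ K ∧ ‖x - k‖ = Metric.infDist x K}

/-- A nonempty closed set `K` is Chebyshev if `P_K(x)` is a singleton for every `x ∈ X \ K`. -/
structure IsChebyshevSet {X : Type*} [NormedAddCommGroup X] (K : Set X) : Prop where
  nonempty : K.Nonempty
  isClosed : IsClosed K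
  exists_eq_singleton : ∀ x : X, x ∉ K → ∃ p : X, metricProjection K x = {p}

/-- A nonempty closed set `K` is almost proximinal if the set of those `x ∈ X \ K` for which
`P_K(x)` is nonempty is dense in `X \ K`. -/
structure IsAlmostProximinal {X : Type*} [NormedAddCommGroup X] (K : Set X) : Prop where
  nonempty : K.Nonempty
  isClosed : IsClosed K
  dense_nonempty : Kᶜ ⊆ closure {x : X | x ∉ K ∧ (metricProjection K x).Nonempty}

/-- `p` is a closest point of `K` to `x`, and it is also a closest point of `K` to all points
`x + t • u`, `t ≥ 0`, where `u` is the unit vector in the direction of `x - p`. -/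
def IsSolarClosestPoint {X : Type*} [NormedAddCommGroup X] [NormedSpace ℝ X]
    (K : Set X) (x p : X) : Prop :=
  p ∈ metricProjection K x ∧
    ∀ t : ℝ, 0 ≤ t → p ∈ metricProjection K (x + t • (‖x - p‖⁻¹ • (x - p)))

/-- An almost proximinal set `K` is an almost sun if the set of those `x ∈ X \ K` with a closest
point `p` in `K` which remains a closest point to every point of the ray from `x` in the direction
`x - p` is dense in `X \ K`. -/
structure IsAlmostSun {X : Type*} [NormedAddCommGroup X] [NormedSpace ℝ X]
    (K : Set X) : Prop extends IsAlmostProximinal K where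
  dense_solar : Kᶜ ⊆ closure {x : X | x ∉ K ∧ ∃ p : X, IsSolarClosestPoint K x p}

/-! Along a solar ray from `p` with unit direction `u`, the balls about `p + s • u` of radius `s`
miss `K` and fill out an open convex cone. Hahn–Banach separates each `k ∈ K` from that cone by a
functional norming `u`; rotundity of the dual makes it the same for all `k`, so a half-space
contains `K` and lies below `x` by exactly `d_K(x)`. By density, such half-spaces exclude any convex
combination outside `K`. Conversely, a homothety about `p` shows that closest points of a convex set
are solar. -/

theorem le_norm_sub_of_mem_metricProjection {X : Type*} [NormedAddCommGroup X] {K : Set X}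
    {x p k : X} (hp : p ∈ metricProjection K x) (hk : k ∈ K) : ‖x - p‖ ≤ ‖x - k‖ := by
  rw [hp.2, ← dist_eq_norm]
  exact Metric.infDist_le_dist_of_mem hk

theorem mem_metricProjection_of_forall_le {X : Type*} [NormedAddCommGroup X] {K : Set X}
    {x p : X} (hp : p ∈ K) (h : ∀ k ∈ K, ‖x - p‖ ≤ ‖x - k‖) : p ∈ metricProjection K x := by
  refine ⟨hp, le_antisymm ?_ ?_⟩
  · refine (Metric.le_infDist ⟨p, hp⟩).2 fun k hk => ?_
    rw [dist_eq_norm]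
    exact h k hk
  · rw [← dist_eq_norm]
    exact Metric.infDist_le_dist_of_mem hp

/-- In a convex set, a closest point to `x` is a closest point to every point of the ray from `x`
away from it. -/
theorem Convex.isSolarClosestPoint {X : Type*} [NormedAddCommGroup X] [NormedSpace ℝ X]
    {K : Set X} (hK : Convex ℝ K) {x p : X} (hx : x ∉ K) (hp : p ∈ metricProjection K x) :
    IsSolarClosestPoint K x p := by
  refine ⟨hp, fun t ht => mem_metricProjection_of_forall_le hp.1 fun k hk => ?_⟩
  have hxp : 0 < ‖x - p‖ := norm_sub_pos_iff.2 fun h => hx (h ▸ hp.1)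
  set s : ℝ := 1 + t * ‖x - p‖⁻¹ with hs
  have hs1 : 1 ≤ s := by rw [hs]; linarith [mul_nonneg ht (inv_nonneg.2 hxp.le)]
  have hs0 : 0 < s := by linarith
  -- The homothety of centre `p` and ratio `s` sends `x` to the ray point; its inverse moves `k`
  -- along the segment towards `p`, inside `K`.
  have hmem : p + s⁻¹ • (k - p) ∈ K :=
    hK.add_smul_sub_mem hp.1 hk ⟨by positivity, inv_le_one_of_one_le₀ hs1⟩
  have h := le_norm_sub_of_mem_metricProjection hp hmem
  have e1 : x + t • (‖x - p‖⁻¹ • (x - p)) - p = s • (x - p) := by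
    rw [hs]; module
  have e2 : x + t • (‖x - p‖⁻¹ • (x - p)) - k = s • (x - (p + s⁻¹ • (k - p))) := by
    have : s • (x - (p + s⁻¹ • (k - p))) = s • (x - p) - (k - p) := by
      rw [← sub_sub, smul_sub s (x - p), smul_inv_smul₀ hs0.ne']
    rw [this, ← e1]; abel
  rw [e1, e2, norm_smul, norm_smul]
  gcongr

/-- If `y` lies outside all the open balls of radius `s` about `s • u`, where `u` is a unit vector,
then some functional of norm one that attains its norm at `u` is nonpositive at `y`. -/
theorem exists_norming_functional_nonpos {X : Type*} [NormedAddCommGroup X] [NormedSpace ℝ X]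
    {u y : X} (hu : ‖u‖ = 1) (hy : ∀ s : ℝ, 0 < s → s ≤ ‖s • u - y‖) :
    ∃ g : StrongDual ℝ X, ‖g‖ = 1 ∧ g u = 1 ∧ g y ≤ 0 := by
  let C : Set X := {z | ∃ s : ℝ, 0 < s ∧ ‖s • u - z‖ < s}
  have hCconv : Convex ℝ C := by
    rintro z ⟨s, hs, hz⟩ w ⟨t, ht, hw⟩ a b ha hb hab
    have key : a * ‖s • u - z‖ + b * ‖t • u - w‖ < a * s + b * t := by
      rcases ha.eq_or_lt with rfl | ha
      · have : b = 1 := by linarith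
        subst this; linarith
      · linarith [mul_lt_mul_of_pos_left hz ha, mul_le_mul_of_nonneg_left hw.le hb]
    have hle : ‖(a * s + b * t) • u - (a • z + b • w)‖ ≤
        a * ‖s • u - z‖ + b * ‖t • u - w‖ := by
      have e : (a * s + b * t) • u - (a • z + b • w) = a • (s • u - z) + b • (t • u - w) := by
        module
      rw [e]
      refine (norm_add_le _ _).trans_eq ?_
      rw [norm_smul, norm_smul, Real.norm_of_nonneg ha, Real.norm_of_nonneg hb]
    exact ⟨a * s + b * t, (by positivity : 0 ≤ a * ‖s • u - z‖ + b * ‖t • u - w‖).trans_lt key,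
      hle.trans_lt key⟩
  have hCopen : IsOpen C := by
    have : C = ⋃ s : ℝ, {z | 0 < s ∧ ‖s • u - z‖ < s} := by ext z; simp [C]
    rw [this]
    refine isOpen_iUnion fun s => ?_
    exact isOpen_const.inter (isOpen_lt (f := fun z => ‖s • u - z‖) (by fun_prop) continuous_const)
  have hyC : y ∉ C := fun ⟨s, hs, h⟩ => absurd (hy s hs) (not_le.2 h)
  obtain ⟨f, hf⟩ := geometric_hahn_banach_open_point hCconv hCopen hyC
  have hmem : ∀ z : X, ‖z‖ < 1 → ∀ s : ℝ, 0 < s → s • (u + z) ∈ C := fun z hz s hs => by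
    refine ⟨s, hs, ?_⟩
    have e : s • u - s • (u + z) = -(s • z) := by module
    rw [e, norm_neg, norm_smul, Real.norm_of_nonneg hs.le]
    nlinarith
  have hlt : ∀ z : X, ‖z‖ < 1 → ∀ s : ℝ, 0 < s → s * f (u + z) < f y := fun z hz s hs => by
    simpa [mul_add] using hf _ (hmem z hz s hs)
  have hnonpos : ∀ z : X, ‖z‖ < 1 → f (u + z) ≤ 0 := fun z hz => by
    by_contra! hpos
    -- On a cone, a functional bounded above is nonpositive: this scale gives the value `|f y| + 1`.
    have h := hlt z hz ((|f y| + 1) / f (u + z)) (by positivity)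
    rw [div_mul_cancel₀ _ hpos.ne'] at h
    linarith [le_abs_self (f y)]
  have hfy : 0 ≤ f y := by
    by_contra! hneg
    have hb : f u ≤ 0 := by simpa using hnonpos 0 (by simp)
    have h := hlt 0 (by simp) (-f y / (1 - f u)) (div_pos (by linarith) (by linarith))
    rw [add_zero, div_mul_eq_mul_div, div_lt_iff₀ (by linarith)] at h
    nlinarith
  have hfu : f u ≤ 0 := by simpa using hnonpos 0 (by simp)
  -- `f ≤ 0` on the open unit ball about `u`, so `-f` attains its norm at `u`.
  have hnorm : ‖f‖ ≤ -f u := by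
    refine f.opNorm_le_of_unit_norm (by linarith) fun z hz => ?_
    have hbound : ∀ w : X, ‖w‖ = 1 → f w ≤ -f u := fun w hw => by
      by_contra! hlt'
      have hfw : 0 < f w := by linarith
      obtain ⟨c, hc1, hc2⟩ := exists_between ((div_lt_one hfw).2 hlt')
      have hc0 : 0 ≤ c := (div_nonneg (by linarith) hfw.le).trans hc1.le
      have h := hnonpos (c • w) (by rwa [norm_smul, hw, mul_one, Real.norm_of_nonneg hc0])
      rw [div_lt_iff₀ hfw] at hc1
      rw [map_add, map_smul, smul_eq_mul] at h
      linarith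
    rw [Real.norm_eq_abs, abs_le]
    have := hbound (-z) (by simpa using hz)
    rw [map_neg] at this
    exact ⟨by linarith, hbound z hz⟩
  have hfne : f ≠ 0 := by
    rintro rfl
    simpa using hlt 0 (by simp) 1 one_pos
  have hpos : 0 < ‖f‖ := norm_pos_iff.2 hfne
  have heq : -f u = ‖f‖ := by
    refine le_antisymm ?_ hnorm
    have := f.le_opNorm u
    rw [hu, mul_one] at this
    exact (neg_le_abs _).trans this
  refine ⟨-(‖f‖⁻¹ • f), ?_, ?_, ?_⟩
  · rw [norm_neg, norm_smul, norm_inv, norm_norm, inv_mul_cancel₀ hpos.ne']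
  · have : f u = -‖f‖ := by linarith
    simp [this, hpos.ne']
  · simpa using mul_nonneg (inv_nonneg.2 hpos.le) hfy

/-- When the dual is strictly convex, the functional of norm one attaining its norm at a given unit
vector is unique. -/
theorem eq_of_norming {X : Type*} [NormedAddCommGroup X] [NormedSpace ℝ X]
    [StrictConvexSpace ℝ (StrongDual ℝ X)] {u : X} (hu : ‖u‖ = 1) {f g : StrongDual ℝ X}
    (hf : ‖f‖ = 1) (hg : ‖g‖ = 1) (hfu : f u = 1) (hgu : g u = 1) : f = g := by
  refine eq_of_norm_eq_of_norm_add_eq (hf.trans hg.symm) (le_antisymm (norm_add_le _ _) ?_)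
  have h := (le_abs_self _).trans ((f + g).le_opNorm u)
  rw [hu, mul_one, add_apply, hfu, hgu] at h
  rwa [hf, hg]

/-- A point with a solar closest point is separated from `K` by a functional of norm one, with gap
the distance to `K`. -/
theorem IsSolarClosestPoint.exists_separating {X : Type*} [NormedAddCommGroup X] [NormedSpace ℝ X]
    [StrictConvexSpace ℝ (StrongDual ℝ X)] {K : Set X} {x p : X} (hx : x ∉ K)
    (h : IsSolarClosestPoint K x p) :
    ∃ g : StrongDual ℝ X, ‖g‖ = 1 ∧ ∀ k ∈ K, g k + Metric.infDist x K ≤ g x := by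
  have hr : 0 < ‖x - p‖ := norm_sub_pos_iff.2 fun e => hx (e ▸ h.1.1)
  set u : X := ‖x - p‖⁻¹ • (x - p) with hu_def
  have hu : ‖u‖ = 1 := by
    rw [hu_def, norm_smul, norm_inv, norm_norm, inv_mul_cancel₀ hr.ne']
  have hxu : x = p + ‖x - p‖ • u := by
    rw [hu_def, smul_inv_smul₀ hr.ne']; abel
  have hball : ∀ k ∈ K, ∀ s : ℝ, 0 < s → s ≤ ‖s • u - (k - p)‖ := by
    intro k hk s hs
    have hfar : ∀ t : ℝ, 0 ≤ t → ‖x - p‖ + t ≤ ‖(‖x - p‖ + t) • u - (k - p)‖ := fun t ht => by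
      have h1 := le_norm_sub_of_mem_metricProjection (h.2 t ht) hk
      have e1 : x + t • u - p = (‖x - p‖ + t) • u := by
        rw [add_smul]; nth_rewrite 1 [hxu]; abel
      have e2 : x + t • u - k = (‖x - p‖ + t) • u - (k - p) := by
        rw [← e1]; abel
      rwa [e1, e2, norm_smul, hu, mul_one, Real.norm_of_nonneg (by positivity)] at h1
    have h2 := hfar s hs.le
    -- Balls before `x` on the ray lie inside the later ones.
    have h3 : ‖(‖x - p‖ + s) • u - (k - p)‖ ≤ ‖x - p‖ + ‖s • u - (k - p)‖ := by
      have e : (‖x - p‖ + s) • u - (k - p) = ‖x - p‖ • u + (s • u - (k - p)) := by module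
      rw [e]
      refine (norm_add_le _ _).trans_eq ?_
      rw [norm_smul, hu, mul_one, norm_norm]
    linarith
  obtain ⟨g, hg, hgu, -⟩ := exists_norming_functional_nonpos hu (hball p h.1.1)
  refine ⟨g, hg, fun k hk => ?_⟩
  obtain ⟨g', hg', hgu', hk'⟩ := exists_norming_functional_nonpos hu (hball k hk)
  -- Rotundity enters here: the functional no longer depends on `k`.
  obtain rfl := eq_of_norming hu hg' hg hgu' hgu
  have hgx : g' x = g' p + ‖x - p‖ := by
    nth_rewrite 1 [hxu]; simp [hgu]
  rw [map_sub] at hk'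
  rw [hgx, ← h.1.2]
  linarith

/-- If the dual is strictly convex, then every almost sun is convex. -/
theorem IsAlmostSun.convex {X : Type*} [NormedAddCommGroup X] [NormedSpace ℝ X]
    [StrictConvexSpace ℝ (StrongDual ℝ X)] {K : Set X} (hK : IsAlmostSun K) : Convex ℝ K := by
  intro a ha b hb α β hα hβ hαβ
  by_contra hx
  set x : X := α • a + β • b with hx_def
  have hd : 0 < Metric.infDist x K := (hK.isClosed.notMem_iff_infDist_pos hK.nonempty).1 hx
  -- Half suffices: separation gives `d_K(y) ≤ dist x y`, hence `d_K(x) ≤ 2 * dist x y`.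
  obtain ⟨y, ⟨hy, p, hp⟩, hxy⟩ := Metric.mem_closure_iff.1 (hK.dense_solar hx) _ (half_pos hd)
  obtain ⟨g, hg, hsep⟩ := hp.exists_separating hy
  have h1 : Metric.infDist x K ≤ Metric.infDist y K + dist x y := Metric.infDist_le_infDist_add_dist
  have h2 : g y - g x ≤ dist x y := by
    have h := (le_abs_self _).trans (g.le_opNorm (y - x))
    rwa [hg, one_mul, map_sub, ← dist_eq_norm, dist_comm] at h
  have h3 : g x = α * g a + β * g b := by simp [hx_def]
  have h4 : α * g a + β * g b ≤ g y - Metric.infDist y K := by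
    have ha' := mul_le_mul_of_nonneg_left (le_sub_iff_add_le.2 (hsep a ha)) hα
    have hb' := mul_le_mul_of_nonneg_left (le_sub_iff_add_le.2 (hsep b hb)) hβ
    calc α * g a + β * g b ≤ (α + β) * (g y - Metric.infDist y K) := by linarith
      _ = g y - Metric.infDist y K := by rw [hαβ, one_mul]
  linarith

theorem mainTheorem3 {X : Type*} [NormedAddCommGroup X] [NormedSpace ℝ X] [CompleteSpace X]
    [StrictConvexSpace ℝ (StrongDual ℝ X)] (K : Set X) (hK : IsChebyshevSet K) :
    Convex ℝ K ↔ IsAlmostSun K := by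
  refine ⟨fun hconv => ?_, fun h => h.convex⟩
  have hproj : ∀ x : X, x ∉ K → ∃ p : X, p ∈ metricProjection K x := fun x hx => by
    obtain ⟨p, hp⟩ := hK.exists_eq_singleton x hx
    exact ⟨p, hp ▸ Set.mem_singleton p⟩
  refine ⟨⟨hK.nonempty, hK.isClosed, fun x hx => subset_closure ⟨hx, hproj x hx⟩⟩,
    fun x hx => subset_closure ⟨hx, ?_⟩⟩
  obtain ⟨p, hp⟩ := hproj x hx
  exact ⟨p, hconv.isSolarClosestPoint hx hp⟩
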